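/- Let $V$ be an $n$-dimensional complex vector space with dual $V^*$. The group $GL(V)$ acts naturally on $V\otimes V^*$, by $g\cdot(v\otimes f)=gv\otimes (f\circ g^{-1})$, and hence by algebra automorphisms on the exterior algebra $\Lambda(V\otimes V^*)$; let $\Lambda(V\otimes V^*)^{GL(V)}$ denote the algebra of invariants. Let $e_1,\dots,e_n$ be a basis of $V$ with dual basis $e_1^*,\dots,e_n^*$, put $x_{ij}=e_i\otimes e_j^*\in V\otimes V^*\subset\Lambda(V\otimes V^*)$, let $X=(x_{ij})_{1\le i,j\le n}\in\operatorname{Mat}_{n,n}(\Lambda(V\otimes V^*))$, and put $$q_k=\operatorname{tr}(X^k)=\sum_{1\le i_1,\dots,i_k\le n}x_{i_1i_2}\wedge x_{i_2i_3}\wedge\cdots\wedge x_{i_ki_1}\qquad(k\ge 1).$$ Then the algebra $\Lambda(V\otimes V^*)^{GL(V)}$ is generated by $q_1,q_3,\dots,q_{2n-1}$. These generators anticommute with each other ($q_kq_l=-q_lq_k$ for all odd $k,l$ with $0<k,l<2n$, including $k=l$) and satisfy no relations besides this anticommutativity: the kernel of the homomorphism from the free associative $\mathbb{C}$-algebra on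 $y_1,\dots,y_n$ to $\Lambda(V\otimes V^*)$ with $y_i\mapsto q_{2i-1}$ is the two-sided ideal generated by the elements $y_iy_j+y_jy_i$ ($1\le i,j\le n$). Namely, the products $$q_{k_1}\cdots q_{k_d},\qquad k_1,\dots,k_d \text{ odd},\quad 0<k_1<\cdots<k_d<2n,\quad d=0,1,\dots,n,$$ form a linear basis of $\Lambda(V\otimes V^*)^{GL(V)}$. Thus $\Lambda(V\otimes V^*)^{GL(V)}$ is isomorphic to the exterior algebra on an $n$-dimensional vector space, by an algebra isomorphism that sends a basis of that space to $q_1,q_3,\dots,q_{2n-1}$. -/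

import Mathlib

open scoped TensorProduct

noncomputable section

namespace ExteriorInvariants

/-- The tautological representation of `GL(V)` on `V`. -/
def stdRep (V : Type*) [AddCommGroup V] [Module ℂ V] :
    Representation ℂ (LinearMap.GeneralLinearGroup ℂ V) V :=
  Units.coeHom (V →ₗ[ℂ] V)

/-- The natural representation of `GL(V)` on `V ⊗ V*`, that is
`g • (v ⊗ f) = g v ⊗ (f ∘ g⁻¹)`. -/
def tensorDualRep (V : Type*) [AddCommGroup V] [Module ℂ V] :
    Representation ℂ (LinearMap.GeneralLinearGroup ℂ V) (V ⊗[ℂ] Module.Dual ℂ V) :=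
  (stdRep V).tprod (stdRep V).dual

/-- The exterior algebra `Λ(V ⊗ V*)`. -/
abbrev Ext (V : Type*) [AddCommGroup V] [Module ℂ V] : Type _ :=
  ExteriorAlgebra ℂ (V ⊗[ℂ] Module.Dual ℂ V)

/-- The natural action of `GL(V)` on `Λ(V ⊗ V*)` by algebra endomorphisms. -/
def extAction (V : Type*) [AddCommGroup V] [Module ℂ V] :
    LinearMap.GeneralLinearGroup ℂ V →* (Ext V →ₐ[ℂ] Ext V) where
  toFun g := ExteriorAlgebra.map (tensorDualRep V g)
  map_one' := by
    rw [map_one]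
    exact ExteriorAlgebra.map_id
  map_mul' g h := by
    rw [map_mul]
    exact (ExteriorAlgebra.map_comp_map _ _).symm

/-- The algebra `Λ(V ⊗ V*)^{GL(V)}` of invariants. -/
def invariants (V : Type*) [AddCommGroup V] [Module ℂ V] : Subalgebra ℂ (Ext V) where
  carrier := {w | ∀ g : LinearMap.GeneralLinearGroup ℂ V, extAction V g w = w}
  mul_mem' ha hb g := by rw [map_mul, ha g, hb g]
  add_mem' ha hb g := by rw [map_add, ha g, hb g]
  algebraMap_mem' r g := (extAction V g).commutes r

/-- The matrix `X = (x_{ij})` with entries `x_{ij} = e_i ⊗ e_j^*` in `Λ(V ⊗ V*)`, where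
`e_1, …, e_n` is the given basis of `V` and `e_1^*, …, e_n^*` is the dual basis. -/
def X {V : Type*} [AddCommGroup V] [Module ℂ V] {n : ℕ} (b : Module.Basis (Fin n) ℂ V) :
    Matrix (Fin n) (Fin n) (Ext V) :=
  Matrix.of fun i j => ExteriorAlgebra.ι ℂ (b i ⊗ₜ[ℂ] b.coord j)

/-- `q_k = tr(X^k)`. -/
def q {V : Type*} [AddCommGroup V] [Module ℂ V] {n : ℕ} (b : Module.Basis (Fin n) ℂ V)
    (k : ℕ) : Ext V :=
  (X b ^ k).trace

/-- For `S = {i_1 < ⋯ < i_d} ⊆ {0, …, n - 1}`, the ordered product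
`q_{2 i_1 + 1} q_{2 i_2 + 1} ⋯ q_{2 i_d + 1}`. -/
def qProd {V : Type*} [AddCommGroup V] [Module ℂ V] {n : ℕ} (b : Module.Basis (Fin n) ℂ V)
    (S : Finset (Fin n)) : Ext V :=
  ((S.sort (· ≤ ·)).map fun i => q b (2 * (i : ℕ) + 1)).prod

/-- The homomorphism from the free associative algebra on `n` generators that sends the `i`-th
generator (`i = 0, …, n - 1`) to `q_{2 i + 1}`; its kernel consists of all relations between
`q_1, q_3, …, q_{2n-1}`. -/
def qHom {V : Type*} [AddCommGroup V] [Module ℂ V] {n : ℕ} (b : Module.Basis (Fin n) ℂ V) :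
    FreeAlgebra ℂ (Fin n) →ₐ[ℂ] Ext V :=
  FreeAlgebra.lift ℂ fun i : Fin n => q b (2 * (i : ℕ) + 1)

/-- The two-sided ideal of the free associative algebra on `n` generators that is generated by the
anticommutators `x_i x_j + x_j x_i` (including `i = j`). -/
def anticommIdeal (n : ℕ) : TwoSidedIdeal (FreeAlgebra ℂ (Fin n)) :=
  TwoSidedIdeal.span {r | ∃ i j : Fin n,
    r = FreeAlgebra.ι ℂ i * FreeAlgebra.ι ℂ j + FreeAlgebra.ι ℂ j * FreeAlgebra.ι ℂ i}

end ExteriorInvariants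

end

/-! An invariant of degree `m` is the image of an endomorphism of `V^{⊗m}` commuting with `GL(V)`,
which is a combination of permutations by the double commutant theorem. Contracting with a
permutation gives a product of traces `tr X^k`, one for each cycle, so these traces generate the
invariants. Rotating the cycle shows that the even ones vanish. Hence the traces of all powers of
`X²`, a matrix over a commutative ring, vanish, and `X^{2n} = 0` by Cayley–Hamilton; this leaves
`q_1, q_3, …, q_{2n-1}`.

For independence, the top form is invariant. Its degree is `n² = 1 + 3 + ⋯ + (2n - 1)`, so it must
be a multiple of `q_1 q_3 ⋯ q_{2n-1}`, which is therefore nonzero. A homomorphism from an exterior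
algebra which does not kill the top form is injective. -/

namespace ExteriorInvariants

section TracePowers

open Polynomial Matrix

variable {R ι : Type*} [CommRing R] [Fintype ι] [DecidableEq ι]

/-- Jacobi's formula. -/
theorem derivative_det (A : Matrix ι ι R[X]) :
    derivative A.det = (A.adjugate * A.map derivative).trace := by
  have hcol (i : ι) : (A.adjugate * A.map derivative) i i =
      (A.updateCol i fun k => derivative (A k i)).det := by
    rw [← cramer_apply, cramer_eq_adjugate_mulVec]
    rfl
  simp only [trace, diag_apply, hcol, det_apply, derivative_sum]
  rw [Finset.sum_comm]
  refine Finset.sum_congr rfl fun σ _ => ?_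
  rw [Units.smul_def, derivative_smul, derivative_prod_finset, Finset.smul_sum]
  refine Finset.sum_congr rfl fun i _ => congrArg _ ?_
  rw [← Finset.prod_erase_mul _ _ (Finset.mem_univ i), updateCol_self]
  congr 1
  exact Finset.prod_congr rfl fun j hj => (updateCol_ne (Finset.ne_of_mem_erase hj)).symm

/-- The matrix `1 - t M` over `R[t]`, whose determinant is `M.charpolyRev`. -/
noncomputable def charmatrixRev (M : Matrix ι ι R) : Matrix ι ι R[X] :=
  1 - (Polynomial.X : R[X]) • M.map C

theorem derivative_charpolyRev (M : Matrix ι ι R) :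
    derivative M.charpolyRev = -((charmatrixRev M).adjugate * M.map C).trace := by
  have hder : (charmatrixRev M).map derivative = -M.map C := by
    ext1 i j
    by_cases hij : i = j <;> simp [charmatrixRev, hij]
  rw [charpolyRev, ← charmatrixRev, derivative_det, hder, mul_neg, trace_neg]

theorem trace_adjugate_charmatrixRev_mul_pow (M : Matrix ι ι R) (k : ℕ) :
    ((charmatrixRev M).adjugate * M.map C ^ k).trace = M.charpolyRev * C (M ^ k).trace +
      Polynomial.X * ((charmatrixRev M).adjugate * M.map C ^ (k + 1)).trace := by
  have hadj : (charmatrixRev M).adjugate = M.charpolyRev • 1 +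
      (Polynomial.X : R[X]) • ((charmatrixRev M).adjugate * M.map C) := by
    rw [charpolyRev, ← charmatrixRev, ← adjugate_mul, ← mul_smul_comm, ← mul_add, charmatrixRev,
      sub_add_cancel, mul_one]
  have htrace : (M.map C ^ k).trace = C (M ^ k).trace := by
    rw [← Matrix.map_pow, ← AddMonoidHom.map_trace]
  conv_lhs => rw [hadj]
  rw [add_mul, trace_add, smul_mul_assoc, one_mul, trace_smul, smul_mul_assoc, trace_smul,
    mul_assoc, ← pow_succ', htrace, smul_eq_mul, smul_eq_mul]

theorem charpolyRev_eq_one_of_trace_pow_eq_zero [IsAddTorsionFree R] (M : Matrix ι ι R)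
    (h : ∀ k : ℕ, 0 < k → (M ^ k).trace = 0) : M.charpolyRev = 1 := by
  have hpow (k : ℕ) : ((charmatrixRev M).adjugate * M.map C).trace =
      Polynomial.X ^ k * ((charmatrixRev M).adjugate * M.map C ^ (k + 1)).trace := by
    induction k with
    | zero => simp
    | succ k ih =>
      rw [ih, trace_adjugate_charmatrixRev_mul_pow, h _ k.succ_pos, C_0, mul_zero, zero_add,
        pow_succ Polynomial.X, mul_assoc]
  have hder : derivative M.charpolyRev = 0 := by
    ext k
    refine X_pow_dvd_iff.1 (dvd_trans ?_ (derivative_charpolyRev M).symm.dvd) k k.lt_succ_self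
    exact dvd_neg.2 ⟨_, hpow (k + 1)⟩
  rw [eq_C_of_derivative_eq_zero hder, coeff_zero_eq_eval_zero, eval_charpolyRev, C_1]

theorem pow_card_eq_zero_of_trace_pow_eq_zero [IsAddTorsionFree R] (M : Matrix ι ι R)
    (h : ∀ k : ℕ, 0 < k → (M ^ k).trace = 0) : M ^ Fintype.card ι = 0 := by
  nontriviality R
  have hchar : M.charpoly = Polynomial.X ^ Fintype.card ι := by
    rw [← reflect_reflect (N := M.charpoly.natDegree) (p := M.charpoly), ← reverse,
      reverse_charpoly, charpolyRev_eq_one_of_trace_pow_eq_zero M h, reflect_one,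
      charpoly_natDegree_eq_dim]
  simpa [hchar] using M.aeval_self_charpoly

open scoped IsMulCommutative in
theorem pow_card_eq_zero_of_commute_of_trace_pow_eq_zero {A : Type*} [Ring A] [IsAddTorsionFree A]
    (M : Matrix ι ι A) (hM : ∀ i j k l, Commute (M i j) (M k l))
    (h : ∀ k : ℕ, 0 < k → (M ^ k).trace = 0) : M ^ Fintype.card ι = 0 := by
  let S := Subring.closure {x | ∃ i j, M i j = x}
  have : IsMulCommutative S := Subring.isMulCommutative_closure <| by
    rintro _ ⟨i, j, rfl⟩ _ ⟨k, l, rfl⟩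
    exact hM i j k l
  have : IsAddTorsionFree S := Subtype.val_injective.isAddTorsionFree S.subtype.toAddMonoidHom
  let N : Matrix ι ι S := of fun i j => ⟨M i j, Subring.subset_closure ⟨i, j, rfl⟩⟩
  have hN (k : ℕ) : (N ^ k).map S.subtype = M ^ k := Matrix.map_pow N S.subtype k
  have htrace (k : ℕ) (hk : 0 < k) : (N ^ k).trace = 0 := by
    refine Subtype.val_injective ?_
    change S.subtype.toAddMonoidHom _ = _
    rw [AddMonoidHom.map_trace]
    exact (congrArg trace (hN k)).trans (h k hk)
  rw [← hN, pow_card_eq_zero_of_trace_pow_eq_zero N htrace, Matrix.map_zero _ (map_zero _)]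

end TracePowers

section GradedCommutativity

open ExteriorAlgebra

variable {R M : Type*} [CommRing R] [AddCommGroup M] [Module R M]

theorem ι_mul_of_mem_exteriorPower (v : M) {p : ℕ} {x : ExteriorAlgebra R M}
    (hx : x ∈ ⋀[R]^p M) : ι R v * x = (-1 : R) ^ p • (x * ι R v) := by
  induction hx using Submodule.pow_induction_on_left' with
  | algebraMap r => rw [pow_zero, one_smul, Algebra.commutes]
  | add x y i _ _ ihx ihy => rw [mul_add, ihx, ihy, add_mul, smul_add]
  | mem_mul u hu i x _ ih =>
    obtain ⟨u, rfl⟩ := hu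
    rw [← mul_assoc, eq_neg_of_add_eq_zero_left (ι_add_mul_swap v u), neg_mul, mul_assoc, ih,
      mul_smul_comm, ← mul_assoc, pow_succ, mul_neg_one, neg_smul]

theorem mul_comm_of_mem_exteriorPower {p k : ℕ} {x y : ExteriorAlgebra R M}
    (hx : x ∈ ⋀[R]^p M) (hy : y ∈ ⋀[R]^k M) : x * y = (-1 : R) ^ (p * k) • (y * x) := by
  induction hx using Submodule.pow_induction_on_left' with
  | algebraMap r => rw [zero_mul, pow_zero, one_smul, Algebra.commutes]
  | add x y i _ _ ihx ihy => rw [mul_add, add_mul, ihx, ihy, smul_add]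
  | mem_mul v hv i x _ ih =>
    obtain ⟨v, rfl⟩ := hv
    rw [mul_assoc, ih, mul_smul_comm, ← mul_assoc, ι_mul_of_mem_exteriorPower v hy, smul_mul_assoc,
      smul_smul, mul_assoc, ← pow_add, Nat.succ_mul]

end GradedCommutativity

section MatrixOfOneForms

variable {R M κ : Type*} [CommRing R] [AddCommGroup M] [Module R M] [Fintype κ] [DecidableEq κ]
  {Y : Matrix κ κ (ExteriorAlgebra R M)}

theorem pow_apply_mem_exteriorPower (hY : ∀ i j, Y i j ∈ ⋀[R]^1 M) (p : ℕ) (i j : κ) :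
    (Y ^ p) i j ∈ ⋀[R]^p M := by
  induction p generalizing i j with
  | zero =>
    rw [pow_zero, Matrix.one_apply]
    split_ifs
    · exact SetLike.GradedOne.one_mem
    · exact zero_mem _
  | succ p ih =>
    rw [pow_succ, Matrix.mul_apply]
    exact sum_mem fun l _ => SetLike.GradedMul.mul_mem (ih i l) (hY l j)

theorem trace_pow_mem_exteriorPower (hY : ∀ i j, Y i j ∈ ⋀[R]^1 M) (p : ℕ) :
    (Y ^ p).trace ∈ ⋀[R]^p M :=
  sum_mem fun i _ => pow_apply_mem_exteriorPower hY p i i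

theorem trace_pow_anticomm (hY : ∀ i j, Y i j ∈ ⋀[R]^1 M) {k l : ℕ} (hk : Odd k) (hl : Odd l) :
    (Y ^ k).trace * (Y ^ l).trace = -((Y ^ l).trace * (Y ^ k).trace) := by
  rw [mul_comm_of_mem_exteriorPower (trace_pow_mem_exteriorPower hY k)
    (trace_pow_mem_exteriorPower hY l), (hk.mul hl).neg_one_pow, neg_one_smul]

theorem trace_pow_even_eq_zero [IsAddTorsionFree (ExteriorAlgebra R M)]
    (hY : ∀ i j, Y i j ∈ ⋀[R]^1 M) {k : ℕ} (hk : 0 < k) : (Y ^ (2 * k)).trace = 0 := by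
  -- Rotating the cyclic word by one letter moves a 1-form past a form of odd degree.
  have hrotate : (Y * Y ^ (2 * k - 1)).trace = -(Y ^ (2 * k - 1) * Y).trace := by
    simp only [Matrix.trace, Matrix.diag_apply, Matrix.mul_apply, ← Finset.sum_neg_distrib]
    rw [Finset.sum_comm]
    refine Finset.sum_congr rfl fun i _ => Finset.sum_congr rfl fun j _ => ?_
    rw [mul_comm_of_mem_exteriorPower (hY _ _) (pow_apply_mem_exteriorPower hY _ _ _), one_mul,
      Odd.neg_one_pow ⟨k - 1, by omega⟩, neg_one_smul]
  rw [← pow_succ, ← pow_succ', Nat.sub_add_cancel (by omega)] at hrotate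
  exact self_eq_neg.1 hrotate

theorem pow_two_mul_card_eq_zero [IsAddTorsionFree (ExteriorAlgebra R M)]
    (hY : ∀ i j, Y i j ∈ ⋀[R]^1 M) : Y ^ (2 * Fintype.card κ) = 0 := by
  rw [pow_mul]
  refine pow_card_eq_zero_of_commute_of_trace_pow_eq_zero _ (fun i j k l => ?_) fun k hk => ?_
  · rw [commute_iff_eq, mul_comm_of_mem_exteriorPower (pow_apply_mem_exteriorPower hY 2 i j)
      (pow_apply_mem_exteriorPower hY 2 k l), (even_two.mul_right _).neg_one_pow, one_smul]
  · rw [← pow_mul, trace_pow_even_eq_zero hY hk]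

theorem trace_pow_mem_adjoin [IsAddTorsionFree (ExteriorAlgebra R M)]
    (hY : ∀ i j, Y i j ∈ ⋀[R]^1 M) (k : ℕ) : (Y ^ k).trace ∈ Algebra.adjoin R
      (Set.range fun i : Fin (Fintype.card κ) => (Y ^ (2 * (i : ℕ) + 1)).trace) := by
  obtain ⟨l, rfl | rfl⟩ := k.even_or_odd'
  · rcases l.eq_zero_or_pos with rfl | hl
    · rw [mul_zero, pow_zero, Matrix.trace_one]
      exact natCast_mem _ _
    · rw [trace_pow_even_eq_zero hY hl]
      exact zero_mem _
  · rcases lt_or_ge l (Fintype.card κ) with hl | hl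
    · exact Algebra.subset_adjoin ⟨⟨l, hl⟩, rfl⟩
    · rw [pow_eq_zero_of_le (by omega) (pow_two_mul_card_eq_zero hY), Matrix.trace_zero]
      exact zero_mem _

end MatrixOfOneForms

section Contraction

theorem list_prod_eq_or_eq_neg_of_perm {ι A : Type*} [Ring A] {a : ι → A}
    (h : ∀ i j, a i * a j = a j * a i ∨ a i * a j = -(a j * a i)) {l l' : List ι}
    (hl : l.Perm l') :
    (l.map a).prod = (l'.map a).prod ∨ (l.map a).prod = -(l'.map a).prod := by
  induction hl with
  | nil => exact Or.inl rfl
  | cons x _ ih => rcases ih with ih | ih <;> simp [ih]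
  | swap x y l =>
    simp only [List.map_cons, List.prod_cons, ← mul_assoc]
    rcases h y x with h | h <;> simp [h]
  | trans _ _ ih₁ ih₂ => rcases ih₁ with h₁ | h₁ <;> rcases ih₂ with h₂ | h₂ <;> simp [h₁, h₂]

theorem card_nsmul_sum_eq_sum_sum_update {Λ κ E : Type*} [Fintype Λ] [DecidableEq Λ] [Fintype κ]
    [AddCommMonoid E] (F : (Λ → κ) → E) (v : Λ) :
    Fintype.card κ • ∑ J, F J = ∑ J, ∑ t, F (Function.update J v t) := by
  have hinv : Function.Involutive fun p : (Λ → κ) × κ => (Function.update p.1 v p.2, p.1 v) :=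
    fun p => by simp
  rw [← Fintype.sum_prod_type', ← Finset.card_univ, ← Finset.sum_const, Finset.sum_comm,
    ← Fintype.sum_prod_type']
  exact (Equiv.sum_comp hinv.toPerm fun p => F p.1).symm

variable {R M κ Λ : Type*} [CommRing R] [AddCommGroup M] [Module R M] [Fintype κ] [DecidableEq κ]

/-- The product of matrix entries `∏ (Y ^ p) (J u) (J v)` along a list of weighted directed edges
`(p, u, v)`, the vertices `u`, `v` being labelled with indices by `J`. -/
def edgeProd (Y : Matrix κ κ (ExteriorAlgebra R M)) (l : List (ℕ × Λ × Λ)) (J : Λ → κ) :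
    ExteriorAlgebra R M :=
  (l.map fun e => (Y ^ e.1) (J e.2.1) (J e.2.2)).prod

/-- The full contraction of `edgeProd` over all labellings of the vertices. -/
def contraction [Fintype Λ] [DecidableEq Λ] (Y : Matrix κ κ (ExteriorAlgebra R M))
    (l : List (ℕ × Λ × Λ)) : ExteriorAlgebra R M :=
  ∑ J : Λ → κ, edgeProd Y l J

/-- A list of weighted directed edges `(p, u, v)` forming disjoint cycles: each vertex which occurs
is the source of exactly one edge and the target of exactly one edge. -/
def IsCycleCover (l : List (ℕ × Λ × Λ)) : Prop :=
  (l.map fun e => e.2.1).Nodup ∧ (l.map fun e => e.2.1).Perm (l.map fun e => e.2.2)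

theorem IsCycleCover.perm {l l' : List (ℕ × Λ × Λ)} (h : IsCycleCover l) (hl : l.Perm l') :
    IsCycleCover l' :=
  ⟨(hl.map _).nodup_iff.1 h.1, ((hl.map _).symm.trans h.2).trans (hl.map _)⟩

theorem IsCycleCover.of_cons_loop {l : List (ℕ × Λ × Λ)} {p : ℕ} {u : Λ}
    (h : IsCycleCover ((p, u, u) :: l)) : IsCycleCover l :=
  ⟨(List.nodup_cons.1 h.1).2, (List.perm_cons u).1 h.2⟩

theorem IsCycleCover.merge {l : List (ℕ × Λ × Λ)} {p p' : ℕ} {u v w : Λ}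
    (h : IsCycleCover ((p, u, v) :: (p', v, w) :: l)) : IsCycleCover ((p + p', u, w) :: l) :=
  ⟨h.1.sublist ((List.sublist_cons_self _ _).cons_cons u),
    (List.perm_cons v).1 ((List.Perm.swap u v _).trans h.2)⟩

theorem IsCycleCover.nodup_targets {l : List (ℕ × Λ × Λ)} (h : IsCycleCover l) :
    (l.map fun e => e.2.2).Nodup :=
  h.2.nodup_iff.1 h.1

theorem IsCycleCover.exists_perm_cons_cons {l : List (ℕ × Λ × Λ)} {p : ℕ} {u v : Λ}
    (h : IsCycleCover ((p, u, v) :: l)) (huv : u ≠ v) :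
    ∃ p' w l', ((p, u, v) :: l).Perm ((p, u, v) :: (p', v, w) :: l') := by
  have hv : v ∈ u :: l.map fun e => e.2.1 := h.2.mem_iff.2 List.mem_cons_self
  obtain ⟨⟨p', _, w⟩, he, rfl⟩ := List.mem_map.1 ((List.mem_cons.1 hv).resolve_left huv.symm)
  classical exact ⟨p', w, _, (List.perm_cons_erase he).cons _⟩

variable {Y : Matrix κ κ (ExteriorAlgebra R M)}

theorem edgeProd_update [DecidableEq Λ] {l : List (ℕ × Λ × Λ)} {v : Λ}
    (hsource : v ∉ l.map fun e => e.2.1) (htarget : v ∉ l.map fun e => e.2.2) (J : Λ → κ) (t : κ) :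
    edgeProd Y l (Function.update J v t) = edgeProd Y l J := by
  refine congrArg List.prod (List.map_congr_left fun e he => ?_)
  rw [Function.update_of_ne, Function.update_of_ne]
  · exact fun h => htarget (h ▸ List.mem_map_of_mem he)
  · exact fun h => hsource (h ▸ List.mem_map_of_mem he)

variable [Fintype Λ] [DecidableEq Λ]

theorem contraction_eq_or_eq_neg_of_perm (hY : ∀ i j, Y i j ∈ ⋀[R]^1 M)
    {l l' : List (ℕ × Λ × Λ)} (hl : l.Perm l') :
    contraction Y l = contraction Y l' ∨ contraction Y l = -contraction Y l' := by
  let a (e : ℕ × Λ × Λ) (J : Λ → κ) := (Y ^ e.1) (J e.2.1) (J e.2.2)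
  have ha (e f : ℕ × Λ × Λ) : a e * a f = a f * a e ∨ a e * a f = -(a f * a e) := by
    have hcomm (J : Λ → κ) : a e J * a f J = (-1 : R) ^ (e.1 * f.1) • (a f J * a e J) :=
      mul_comm_of_mem_exteriorPower (pow_apply_mem_exteriorPower hY _ _ _)
        (pow_apply_mem_exteriorPower hY _ _ _)
    rcases neg_one_pow_eq_or R (e.1 * f.1) with h | h <;> rw [h] at hcomm
    · exact Or.inl (funext fun J => by simpa using hcomm J)
    · exact Or.inr (funext fun J => by simpa using hcomm J)
  have hprod (l : List (ℕ × Λ × Λ)) : edgeProd Y l = (l.map a).prod := funext fun J => by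
    rw [Pi.list_prod_apply, List.map_map]
    rfl
  simp only [contraction, hprod]
  rcases list_prod_eq_or_eq_neg_of_perm ha hl with h | h <;> rw [h]
  · exact Or.inl rfl
  · exact Or.inr (Finset.sum_neg_distrib _)

theorem card_nsmul_contraction_loop {l : List (ℕ × Λ × Λ)} {p : ℕ} {u : Λ}
    (h : IsCycleCover ((p, u, u) :: l)) :
    Fintype.card κ • contraction Y ((p, u, u) :: l) = (Y ^ p).trace * contraction Y l := by
  have hsource := (List.nodup_cons.1 h.1).1
  have htarget := (List.nodup_cons.1 h.nodup_targets).1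
  have hcons (J : Λ → κ) (t : κ) : edgeProd Y ((p, u, u) :: l) (Function.update J u t) =
      (Y ^ p) t t * edgeProd Y l J := by
    rw [← edgeProd_update hsource htarget J t]
    simp only [edgeProd, List.map_cons, List.prod_cons, Function.update_self]
  rw [contraction, card_nsmul_sum_eq_sum_sum_update _ u]
  simp only [hcons, ← Finset.sum_mul, ← Finset.mul_sum]
  rfl

theorem card_nsmul_contraction_merge {l : List (ℕ × Λ × Λ)} {p p' : ℕ} {u v w : Λ}
    (h : IsCycleCover ((p, u, v) :: (p', v, w) :: l)) :
    Fintype.card κ • contraction Y ((p, u, v) :: (p', v, w) :: l) =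
      contraction Y ((p + p', u, w) :: l) := by
  have hsource : u ≠ v ∧ v ∉ l.map fun e => e.2.1 := by
    have := h.1
    simp only [List.map_cons, List.nodup_cons, List.mem_cons, not_or] at this
    exact ⟨this.1.1, this.2.1⟩
  have htarget : v ≠ w ∧ v ∉ l.map fun e => e.2.2 := by
    have := h.nodup_targets
    simp only [List.map_cons, List.nodup_cons, List.mem_cons, not_or] at this
    exact this.1
  have hcons (J : Λ → κ) (t : κ) :
      edgeProd Y ((p, u, v) :: (p', v, w) :: l) (Function.update J v t) =
        (Y ^ p) (J u) t * (Y ^ p') t (J w) * edgeProd Y l J := by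
    rw [← edgeProd_update hsource.2 htarget.2 J t]
    simp only [edgeProd, List.map_cons, List.prod_cons, Function.update_self, mul_assoc,
      Function.update_of_ne hsource.1, Function.update_of_ne htarget.1.symm]
  rw [contraction, card_nsmul_sum_eq_sum_sum_update _ v]
  simp only [hcons, ← Finset.sum_mul, ← Matrix.mul_apply, ← pow_add]
  rfl

theorem contraction_mem_adjoin {K : Type*} [Field K] [CharZero K] [Module K M]
    {Y : Matrix κ κ (ExteriorAlgebra K M)} (hY : ∀ i j, Y i j ∈ ⋀[K]^1 M)
    {l : List (ℕ × Λ × Λ)} (hl : IsCycleCover l) :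
    contraction Y l ∈ Algebra.adjoin K (Set.range fun k => (Y ^ k).trace) := by
  set S := Algebra.adjoin K (Set.range fun k => (Y ^ k).trace)
  have of_card_nsmul {p : ℕ} {u v : Λ} {l : List (ℕ × Λ × Λ)}
      (h : Fintype.card κ • contraction Y ((p, u, v) :: l) ∈ S) :
      contraction Y ((p, u, v) :: l) ∈ S := by
    rcases isEmpty_or_nonempty κ with hκ | hκ
    · have : IsEmpty (Λ → κ) := ⟨fun J => hκ.elim (J u)⟩
      rw [contraction, Finset.univ_eq_empty, Finset.sum_empty]
      exact zero_mem _
    · rw [← Nat.cast_smul_eq_nsmul K] at h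
      exact (S.toSubmodule.smul_mem_iff (Nat.cast_ne_zero.2 Fintype.card_ne_zero)).1 h
  induction hlen : l.length generalizing l with
  | zero =>
    obtain rfl := List.length_eq_zero_iff.1 hlen
    exact sum_mem fun _ _ => one_mem _
  | succ N ih =>
    obtain ⟨⟨p, u, v⟩, l, rfl⟩ := List.exists_cons_of_length_eq_add_one hlen
    rw [List.length_cons, Nat.add_right_cancel_iff] at hlen
    rcases eq_or_ne u v with rfl | huv
    · refine of_card_nsmul ?_
      rw [card_nsmul_contraction_loop hl]
      exact mul_mem (Algebra.subset_adjoin ⟨p, rfl⟩) (ih hl.of_cons_loop hlen)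
    · obtain ⟨p', w, l', hperm⟩ := hl.exists_perm_cons_cons huv
      have hl' := hl.perm hperm
      have hmem : contraction Y ((p, u, v) :: (p', v, w) :: l') ∈ S := of_card_nsmul <| by
        rw [card_nsmul_contraction_merge hl']
        refine ih hl'.merge ?_
        simpa [hlen] using hperm.length_eq.symm
      rcases contraction_eq_or_eq_neg_of_perm hY hperm with h | h <;> rw [h]
      exacts [hmem, neg_mem hmem]

end Contraction

section DoubleCommutant

open Representation

theorem exists_eq_sum_smul_of_commute_intertwiningMap {K G W : Type*} [Field K] [Group G]
    [Fintype G] [NeZero (Nat.card G : K)] [AddCommGroup W] [Module K W] [Module.Finite K W]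
    (ρ : Representation K G W) (T : Module.End K W)
    (hT : ∀ φ : ρ.IntertwiningMap ρ, Commute φ.toLinearMap T) :
    ∃ c : G → K, T = ∑ g, c g • ρ g := by
  classical
  let e : ρ.asModule ≃ₗ[K] W := ρ.asModuleEquiv
  let f : Module.End (Module.End (MonoidAlgebra K G) ρ.asModule) ρ.asModule :=
    { toFun := fun m => e.symm (T (e m))
      map_add' := fun x y => by simp only [map_add]
      map_smul' := fun φ m => congrArg e.symm <| .symm <|
        LinearMap.congr_fun (hT ((IntertwiningMap.equivAlgEnd ρ).symm φ)) (e m) }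
  obtain ⟨s, hs⟩ := Module.Finite.fg_top (R := K) (M := W)
  obtain ⟨r, hr⟩ := jacobson_density f (s.image e.symm)
  have hrT : T = ρ.asAlgebraHom r := by
    refine LinearMap.ext_on hs fun w hw => ?_
    have := congrArg e (hr _ (Finset.mem_image_of_mem _ hw))
    rwa [asModuleEquiv_map_smul, e.apply_symm_apply] at this
  refine ⟨r.coeff, ?_⟩
  rw [hrT, asAlgebraHom_def, MonoidAlgebra.lift_apply, Finsupp.sum_fintype _ _ (by simp)]

end DoubleCommutant

section SchurWeyl

theorem exists_perm_comp_eq {ι κ : Type*} [Fintype ι] [DecidableEq κ] {w w' : ι → κ}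
    (h : ∀ c, Fintype.card {k // w k = c} = Fintype.card {k // w' k = c}) :
    ∃ σ : Equiv.Perm ι, w' ∘ σ = w :=
  ⟨Equiv.ofFiberEquiv fun c => Fintype.equivOfCardEq (h c),
    funext fun k => Equiv.ofFiberEquiv_map _ k⟩

/-- The polynomial relation `hc` only sees the multiset of letters of a word, so it may be
evaluated on any function of words with that property. -/
theorem sum_mul_eq_zero_of_sum_monomial_eq_zero {R ι κ : Type*} [CommRing R] [Fintype ι]
    [DecidableEq ι] [Fintype κ] (c A : (ι → κ) → R)
    (hA : ∀ (σ : Equiv.Perm ι) w, A (w ∘ σ) = A w)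
    (hc : ∑ w, c w • ∏ k, MvPolynomial.X (R := R) (w k) = 0) :
    ∑ w, c w * A w = 0 := by
  classical
  let content (w : ι → κ) : κ →₀ ℕ := ∑ k, Finsupp.single (w k) 1
  have hcontent (w : ι → κ) (d : κ) : content w d = Fintype.card {k // w k = d} := by
    simp [content, Finsupp.single_apply, Fintype.card_subtype]
  have hfactor : A.FactorsThrough content := fun w w' h => by
    obtain ⟨σ, rfl⟩ := exists_perm_comp_eq (w := w) (w' := w') fun d => by
      rw [← hcontent, ← hcontent, h]
    exact hA σ w'
  have hmonomial (w : ι → κ) : ∏ k, MvPolynomial.X (R := R) (w k) =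
      MvPolynomial.basisMonomials κ R (content w) := by
    rw [MvPolynomial.coe_basisMonomials]
    exact (MvPolynomial.monomial_sum_one _ _).symm
  have := congrArg
    ((MvPolynomial.basisMonomials κ R).constr R (Function.extend content A 0)) hc
  simpa only [map_sum, map_smul, map_zero, hmonomial, Module.Basis.constr_basis,
    hfactor.extend_apply, smul_eq_mul] using this

theorem mvPolynomial_eq_zero_of_eval_GL {K κ : Type*} [Field K] [Infinite K] [Fintype κ]
    [DecidableEq κ] (p : MvPolynomial (κ × κ) K)
    (hp : ∀ g : GL κ K, MvPolynomial.eval (fun x => (g : Matrix κ κ K) x.1 x.2) p = 0) :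
    p = 0 := by
  have hz : p * (Matrix.mvPolynomialX κ κ K).det = 0 := by
    refine MvPolynomial.funext fun x => ?_
    have hdet : MvPolynomial.eval x (Matrix.mvPolynomialX κ κ K).det =
        (Matrix.of fun i j => x (i, j)).det := by
      rw [RingHom.map_det]
      congr 1
      ext i j
      simp
    rw [map_mul, map_zero, hdet]
    by_cases h : (Matrix.of fun i j => x (i, j)).det = 0
    · rw [h, mul_zero]
    · exact mul_eq_zero_of_left (hp (Matrix.GeneralLinearGroup.mkOfDetNeZero _ h)) _
  exact (mul_eq_zero.1 hz).resolve_right (Matrix.det_mvPolynomialX_ne_zero κ K)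

variable {R : Type*} [CommRing R] {ι κ : Type*}

/-- The matrix of the tensor power `g ⊗ ⋯ ⊗ g`, the tensor factors being indexed by `ι`. -/
def tensorPowMatrix [Fintype ι] (g : Matrix κ κ R) : Matrix (ι → κ) (ι → κ) R :=
  Matrix.of fun I J => ∏ k, g (I k) (J k)

variable (R ι κ) in
/-- The permutation action on the tensor power `(R ^ κ) ^ ⊗ ι`, whose elements are written as
coordinate functions on words. -/
def permRep : Representation R (Equiv.Perm ι) ((ι → κ) → R) where
  toFun σ := LinearMap.funLeft R R fun I => I ∘ σ
  map_one' := rfl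
  map_mul' _ _ := rfl

theorem permRep_single [DecidableEq κ] [Fintype ι] (σ : Equiv.Perm ι) (J : ι → κ) :
    permRep R ι κ σ (Pi.single (J ∘ σ) 1) = Pi.single J 1 := by
  ext I
  change (Pi.single (J ∘ σ) 1 : (ι → κ) → R) (I ∘ σ) = _
  simp only [Pi.single_apply, σ.surjective.injective_comp_right.eq_iff]

variable {K : Type*} [Field K] [Fintype ι] [DecidableEq ι] [Fintype κ] [DecidableEq κ]

theorem commute_of_commute_tensorPowMatrix [Infinite K] {T A : Matrix (ι → κ) (ι → κ) K}
    (hT : ∀ g : GL κ K, Commute T (tensorPowMatrix (g : Matrix κ κ K)))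
    (hA : ∀ (σ : Equiv.Perm ι) I J, A (I ∘ σ) (J ∘ σ) = A I J) : Commute T A := by
  let e := Equiv.arrowProdEquivProdArrow ι (fun _ => κ) (fun _ => κ)
  ext I J
  let c (w : ι → κ × κ) : K :=
    (if (e w).2 = J then T I (e w).1 else 0) - (if (e w).1 = I then T (e w).2 J else 0)
  have hc (B : Matrix (ι → κ) (ι → κ) K) :
      ∑ w, c w * B (e w).1 (e w).2 = (T * B) I J - (B * T) I J := by
    rw [Equiv.sum_comp e fun p => ((if p.2 = J then T I p.1 else 0) -
      (if p.1 = I then T p.2 J else 0)) * B p.1 p.2]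
    simp only [sub_mul, ite_mul, zero_mul, Finset.sum_sub_distrib]
    congr 1
    · rw [Fintype.sum_prod_type]
      simp [Matrix.mul_apply]
    · rw [Fintype.sum_prod_type_right]
      simp [Matrix.mul_apply, mul_comm]
  have hrel : ∑ w, c w • ∏ k, MvPolynomial.X (R := K) (w k) = 0 := by
    refine mvPolynomial_eq_zero_of_eval_GL _ fun g => ?_
    have hg := hc (tensorPowMatrix (g : Matrix κ κ K))
    rw [(hT g).eq, sub_self] at hg
    rw [← hg, map_sum]
    refine Finset.sum_congr rfl fun w _ => ?_
    simp [tensorPowMatrix, map_prod, e, Equiv.arrowProdEquivProdArrow, MvPolynomial.smul_eval]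
  rw [← sub_eq_zero, ← hc]
  exact sum_mul_eq_zero_of_sum_monomial_eq_zero c _ (fun σ w => hA σ (e w).1 (e w).2) hrel

theorem exists_eq_sum_perm_of_commute_tensorPowMatrix [CharZero K]
    (T : Matrix (ι → κ) (ι → κ) K)
    (hT : ∀ g : GL κ K, Commute T (tensorPowMatrix (g : Matrix κ κ K))) :
    ∃ c : Equiv.Perm ι → K, ∀ I J, T I J = ∑ σ : Equiv.Perm ι, if I ∘ σ = J then c σ else 0 := by
  obtain ⟨c, hc⟩ := exists_eq_sum_smul_of_commute_intertwiningMap (permRep K ι κ) T.toLin'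
    fun φ => by
      have hsym (σ : Equiv.Perm ι) (I J : ι → κ) :
          φ.toLinearMap.toMatrix' (I ∘ σ) (J ∘ σ) = φ.toLinearMap.toMatrix' I J := by
        rw [LinearMap.toMatrix'_apply, LinearMap.toMatrix'_apply, ← permRep_single σ J]
        exact (congrFun (φ.isIntertwining _ _ σ _) I).symm
      have h : Commute T.toLin' φ.toLinearMap.toMatrix'.toLin' :=
        (commute_of_commute_tensorPowMatrix hT hsym).map Matrix.toLinAlgEquiv'
      rw [Matrix.toLin'_toMatrix'] at h
      exact h.symm
  refine ⟨c, fun I J => ?_⟩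
  have h := congrFun (LinearMap.congr_fun hc (Pi.single J 1)) I
  rw [Matrix.toLin'_apply, Matrix.mulVec_single_one, Matrix.col_apply, LinearMap.sum_apply,
    Finset.sum_apply] at h
  rw [h]
  refine Finset.sum_congr rfl fun σ _ => ?_
  change c σ * (Pi.single J 1 : (ι → κ) → K) (I ∘ σ) = _
  rw [Pi.single_apply, mul_ite, mul_one, mul_zero]

end SchurWeyl

section ExteriorCoordinates

open exteriorPower

variable {R M N κ : Type*} [CommRing R] [AddCommGroup M] [Module R M] [AddCommGroup N] [Module R N]

theorem coe_exteriorPower_map {m : ℕ} (f : M →ₗ[R] N) (y : ⋀[R]^m M) :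
    (exteriorPower.map m f y : ExteriorAlgebra R N) = ExteriorAlgebra.map f y := by
  have : (⋀[R]^m N).subtype ∘ₗ exteriorPower.map m f =
      (ExteriorAlgebra.map f).toLinearMap ∘ₗ (⋀[R]^m M).subtype := by
    ext v
    simp [ExteriorAlgebra.map_apply_ιMulti]
  exact LinearMap.congr_fun this y

theorem exteriorPower_map_decompose (f : M →ₗ[R] N) (x : ExteriorAlgebra R M) (m : ℕ) :
    exteriorPower.map m f (DirectSum.decompose (fun i => ⋀[R]^i M) x m) =
      DirectSum.decompose (fun i => ⋀[R]^i N) (ExteriorAlgebra.map f x) m := by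
  let F : (fun i => ⋀[R]^i M) →+*ᵍ (fun i => ⋀[R]^i N) :=
    { (ExteriorAlgebra.map f).toRingHom with
      map_mem := fun {i y} hy => coe_exteriorPower_map f ⟨y, hy⟩ ▸ Subtype.prop _ }
  exact Subtype.ext <| (coe_exteriorPower_map f _).trans (F.map_directSumDecompose (x := x))

theorem alternatingMap_sum_smul [Fintype κ] {ι : Type*} [Fintype ι] [DecidableEq ι]
    (F : M [⋀^ι]→ₗ[R] N) (c : ι → κ → R) (v : κ → M) :
    F (fun k => ∑ x, c k x • v x) = ∑ w : ι → κ, (∏ k, c k (w k)) • F fun k => v (w k) :=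
  (F.toMultilinearMap.map_sum fun k x => c k x • v x).trans <|
    Finset.sum_congr rfl fun w _ => F.toMultilinearMap.map_smul_univ (fun k => c k (w k)) _

/-- The coordinate of index `w` of an element of `⋀^m M`, seen as an antisymmetric tensor. Words
`w` that differ by a permutation give redundant coordinates. -/
noncomputable def exteriorCoord (B : Module.Basis κ R M) {m : ℕ} (w : Fin m → κ) :
    Module.Dual R (⋀[R]^m M) :=
  alternatingMapToDual R M m fun k => B.coord (w k)

theorem exteriorCoord_ιMulti (B : Module.Basis κ R M) {m : ℕ} (w : Fin m → κ) (v : Fin m → M) :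
    exteriorCoord B w (ιMulti R m v) = (Matrix.of fun i j => B.repr (v i) (w j)).det :=
  alternatingMapToDual_apply_ιMulti _ _

variable [Fintype κ]

theorem sum_exteriorCoord_smul_ιMulti (B : Module.Basis κ R M) {m : ℕ} (y : ⋀[R]^m M) :
    ∑ w : Fin m → κ, exteriorCoord B w y • ιMulti R m (fun k => B (w k)) = m.factorial • y := by
  suffices h : ∑ w : Fin m → κ, (exteriorCoord B w).smulRight (ιMulti R m fun k => B (w k)) =
      m.factorial • LinearMap.id by
    simpa using LinearMap.congr_fun h y
  ext1
  ext1 v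
  have hperm (σ : Equiv.Perm (Fin m)) : ∑ w : Fin m → κ, (Equiv.Perm.sign σ •
      ∏ k, B.repr (v (σ k)) (w k)) • ιMulti R m (fun k => B (w k)) = ιMulti R m v := by
    have hexpand := alternatingMap_sum_smul (ιMulti R m) (fun k x => B.repr (v (σ k)) x) B
    simp only [B.sum_repr] at hexpand
    simp only [smul_assoc, ← Finset.smul_sum, ← hexpand]
    have hsign : ιMulti R m (fun k => v (σ k)) = _ := (ιMulti R m).map_perm v σ
    rw [hsign, smul_smul, Int.units_mul_self, one_smul]
  simp only [LinearMap.compAlternatingMap_apply, LinearMap.sum_apply, LinearMap.smulRight_apply,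
    exteriorCoord_ιMulti, Matrix.det_apply, Matrix.of_apply, Finset.sum_smul]
  rw [Finset.sum_comm, Finset.sum_congr rfl fun σ _ => hperm σ, Finset.sum_const,
    Finset.card_univ, Fintype.card_perm, Fintype.card_fin, LinearMap.smul_apply, LinearMap.id_apply]

theorem exteriorCoord_map [DecidableEq κ] (B : Module.Basis κ R M) {m : ℕ} (f : M →ₗ[R] M)
    (w : Fin m → κ) (y : ⋀[R]^m M) :
    exteriorCoord B w (exteriorPower.map m f y) =
      ∑ w', tensorPowMatrix (LinearMap.toMatrix B B f) w w' * exteriorCoord B w' y := by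
  have hcomp : exteriorCoord B w ∘ₗ exteriorPower.map m f =
      alternatingMapToDual R M m fun k => B.coord (w k) ∘ₗ f := by
    ext v
    simp [exteriorCoord]
  have hcoord (x : κ) : B.coord x ∘ₗ f = ∑ x', LinearMap.toMatrix B B f x x' • B.coord x' :=
    B.ext fun j => by
      simp [LinearMap.toMatrix_apply, Finsupp.single_apply]
  have h := LinearMap.congr_fun hcomp y
  simp only [hcoord, alternatingMap_sum_smul _ (fun k => LinearMap.toMatrix B B f (w k))] at h
  simpa [LinearMap.sum_apply, tensorPowMatrix, exteriorCoord] using h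

end ExteriorCoordinates

section GLInvariants

open scoped Kronecker Matrix

theorem sum_arrow_prod {E ι κ : Type*} [Fintype ι] [DecidableEq ι] [Fintype κ] [AddCommMonoid E]
    (F : (ι → κ × κ) → E) : ∑ w, F w = ∑ I : ι → κ, ∑ J : ι → κ, F fun k => (I k, J k) := by
  rw [← Fintype.sum_prod_type']
  exact Fintype.sum_equiv (Equiv.arrowProdEquivProdArrow ι (fun _ => κ) (fun _ => κ)) _ _
    fun _ => rfl

theorem trace_map_algebraMap_mul {R A ι : Type*} [CommSemiring R] [Semiring A] [Algebra R A]
    [Fintype ι] (P : Matrix ι ι R) (Y : Matrix ι ι A) :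
    (P.map (algebraMap R A) * Y).trace = (Y * P.map (algebraMap R A)).trace := by
  simp only [Matrix.trace, Matrix.diag_apply, Matrix.mul_apply, Matrix.map_apply]
  rw [Finset.sum_comm]
  exact Finset.sum_congr rfl fun i _ => Finset.sum_congr rfl fun j _ => Algebra.commutes _ _

theorem trace_conj_pow {R A ι : Type*} [CommRing R] [Ring A] [Algebra R A] [Fintype ι]
    [DecidableEq ι] {P Q : Matrix ι ι R} (h : P * Q = 1) (Y : Matrix ι ι A) (k : ℕ) :
    ((P.map (algebraMap R A) * Y * Q.map (algebraMap R A)) ^ k).trace = (Y ^ k).trace := by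
  let u : (Matrix ι ι A)ˣ :=
    Units.map (algebraMap R A).mapMatrix.toMonoidHom ⟨P, Q, h, mul_eq_one_comm.1 h⟩
  calc ((u * Y * (u⁻¹).1) ^ k).trace = (u * (Y ^ k * (u⁻¹).1)).trace := by
        rw [Units.conj_pow, mul_assoc]
    _ = (Y ^ k * (u⁻¹).1 * u).trace := trace_map_algebraMap_mul P _
    _ = (Y ^ k).trace := by rw [mul_assoc, Units.inv_mul, mul_one]

section CommRing

variable {R M ι κ : Type*} [CommRing R] [AddCommGroup M] [Module R M] [Fintype ι]

theorem tensorPowMatrix_one [DecidableEq κ] :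
    tensorPowMatrix (1 : Matrix κ κ R) = (1 : Matrix (ι → κ) (ι → κ) R) := by
  classical
  ext I J
  simp only [tensorPowMatrix, Matrix.of_apply, Matrix.one_apply, Finset.prod_ite_zero,
    Finset.prod_const_one, Finset.mem_univ, true_imp_iff, funext_iff]

/-- The matrix of the 1-forms given by a basis indexed by pairs. -/
noncomputable def formMatrix (B : Module.Basis (κ × κ) R M) : Matrix κ κ (ExteriorAlgebra R M) :=
  Matrix.of fun i j => ExteriorAlgebra.ι R (B (i, j))

theorem formMatrix_mem (B : Module.Basis (κ × κ) R M) (i j : κ) :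
    formMatrix B i j ∈ ⋀[R]^1 M :=
  (pow_one (LinearMap.range (ExteriorAlgebra.ι R : M →ₗ[R] _))).ge
    (LinearMap.mem_range_self _ (B (i, j)))

variable [Fintype κ]

theorem tensorPowMatrix_mul [DecidableEq ι] (G H : Matrix κ κ R) :
    tensorPowMatrix (ι := ι) (G * H) = tensorPowMatrix G * tensorPowMatrix H := by
  ext I J
  simp only [tensorPowMatrix, Matrix.of_apply, Matrix.mul_apply, Finset.prod_univ_sum,
    Fintype.piFinset_univ, Finset.prod_mul_distrib]

/-- The endomorphism of `M` corresponding to `v ⊗ f ↦ g v ⊗ (f ∘ g⁻¹)` on `R^κ ⊗ (R^κ)^*`, where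
the vector `B (i, j)` is thought of as `e_i ⊗ e_j^*`. -/
noncomputable def conjMap [DecidableEq κ] (B : Module.Basis (κ × κ) R M) (g : GL κ R) :
    M →ₗ[R] M :=
  Matrix.toLin B B ((g : Matrix κ κ R) ⊗ₖ (↑g⁻¹ : Matrix κ κ R)ᵀ)

theorem det_conjMap [DecidableEq κ] (B : Module.Basis (κ × κ) R M) (g : GL κ R) :
    LinearMap.det (conjMap B g) = 1 := by
  rw [conjMap, LinearMap.det_toLin, Matrix.det_kronecker, Matrix.det_transpose, ← mul_pow,
    ← Matrix.det_mul, Units.mul_inv, Matrix.det_one, one_pow]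

theorem formMatrix_map_conjMap [DecidableEq κ] (B : Module.Basis (κ × κ) R M) (g : GL κ R) :
    (formMatrix B).map (ExteriorAlgebra.map (conjMap B g)) =
      (g : Matrix κ κ R)ᵀ.map (algebraMap R _) * formMatrix B *
        (↑g⁻¹ : Matrix κ κ R)ᵀ.map (algebraMap R _) := by
  ext i j
  simp only [formMatrix, conjMap, Matrix.map_apply, Matrix.of_apply, ExteriorAlgebra.map_apply_ι,
    Matrix.toLin_self, map_sum, map_smul, Fintype.sum_prod_type, Matrix.mul_apply, Finset.sum_mul,
    Matrix.kroneckerMap_apply, Matrix.transpose_apply]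
  rw [Finset.sum_comm]
  refine Finset.sum_congr rfl fun l _ => Finset.sum_congr rfl fun k _ => ?_
  rw [mul_assoc, ← Algebra.commutes, ← mul_assoc, ← map_mul, ← Algebra.smul_def]

theorem map_conjMap_trace_pow [DecidableEq κ] (B : Module.Basis (κ × κ) R M) (g : GL κ R) (k : ℕ) :
    ExteriorAlgebra.map (conjMap B g) (formMatrix B ^ k).trace = (formMatrix B ^ k).trace := by
  have hinv : (g : Matrix κ κ R)ᵀ * (↑g⁻¹ : Matrix κ κ R)ᵀ = 1 := by
    rw [← Matrix.transpose_mul, Units.inv_mul, Matrix.transpose_one]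
  have hpow := map_pow (ExteriorAlgebra.map (conjMap B g)).mapMatrix (formMatrix B) k
  rw [AlgHom.mapMatrix_apply, AlgHom.mapMatrix_apply] at hpow
  rw [AddMonoidHom.map_trace, hpow, formMatrix_map_conjMap, trace_conj_pow hinv]

/-- The coordinates of `y : ⋀^m M`, where `M` has a basis indexed by `κ × κ`, as an endomorphism of
the `m`-th tensor power of `R ^ κ`. -/
noncomputable def coordMatrix (B : Module.Basis (κ × κ) R M) {m : ℕ} (y : ⋀[R]^m M) :
    Matrix (Fin m → κ) (Fin m → κ) R :=
  Matrix.of fun I J => exteriorCoord B (fun k => (I k, J k)) y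

theorem coordMatrix_map_conjMap [DecidableEq κ] (B : Module.Basis (κ × κ) R M) {m : ℕ}
    (g : GL κ R) (y : ⋀[R]^m M) : coordMatrix B (exteriorPower.map m (conjMap B g) y) =
      tensorPowMatrix (g : Matrix κ κ R) * coordMatrix B y *
        tensorPowMatrix (↑g⁻¹ : Matrix κ κ R) := by
  ext I J
  rw [coordMatrix, Matrix.of_apply, exteriorCoord_map, conjMap, LinearMap.toMatrix_toLin,
    sum_arrow_prod, Finset.sum_comm]
  simp only [Matrix.mul_apply, Finset.sum_mul, tensorPowMatrix, coordMatrix, Matrix.of_apply,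
    Matrix.kroneckerMap_apply, Matrix.transpose_apply, Finset.prod_mul_distrib]
  exact Finset.sum_congr rfl fun _ _ => Finset.sum_congr rfl fun _ _ => mul_right_comm _ _ _

theorem commute_coordMatrix [DecidableEq κ] (B : Module.Basis (κ × κ) R M) {m : ℕ} {g : GL κ R}
    {y : ⋀[R]^m M} (hy : exteriorPower.map m (conjMap B g) y = y) :
    Commute (coordMatrix B y) (tensorPowMatrix (g : Matrix κ κ R)) := by
  have h := coordMatrix_map_conjMap B g y
  rw [hy] at h
  rw [commute_iff_eq]
  conv_lhs => rw [h]
  rw [mul_assoc, ← tensorPowMatrix_mul, Units.inv_mul, tensorPowMatrix_one, mul_one]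

theorem coe_ιMulti_eq_edgeProd [DecidableEq κ] (B : Module.Basis (κ × κ) R M) {m : ℕ}
    (σ : Equiv.Perm (Fin m)) (I : Fin m → κ) :
    (exteriorPower.ιMulti R m (fun k => B (I k, I (σ k))) : ExteriorAlgebra R M) =
      edgeProd (formMatrix B) ((List.finRange m).map fun k => (1, k, σ k)) I := by
  rw [exteriorPower.ιMulti_apply_coe, ExteriorAlgebra.ιMulti_apply, List.ofFn_eq_map, edgeProd,
    List.map_map]
  simp only [Function.comp_def, pow_one]
  rfl

theorem isCycleCover_perm {m : ℕ} (σ : Equiv.Perm (Fin m)) :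
    IsCycleCover ((List.finRange m).map fun k => (1, k, σ k)) :=
  ⟨by simpa [List.map_map, Function.comp_def] using List.nodup_finRange m,
    by simpa [List.map_map, Function.comp_def] using (Equiv.Perm.map_finRange_perm σ).symm⟩

theorem factorial_nsmul_eq_sum_smul_contraction [DecidableEq κ] (B : Module.Basis (κ × κ) R M)
    {m : ℕ} (y : ⋀[R]^m M) {c : Equiv.Perm (Fin m) → R}
    (hc : ∀ I J, coordMatrix B y I J = ∑ σ : Equiv.Perm (Fin m), if I ∘ σ = J then c σ else 0) :
    m.factorial • (y : ExteriorAlgebra R M) = ∑ σ : Equiv.Perm (Fin m),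
      c σ • contraction (formMatrix B) ((List.finRange m).map fun k => (1, k, σ k)) := by
  have hcoord (I J : Fin m → κ) : exteriorCoord B (fun k => (I k, J k)) y =
      ∑ σ : Equiv.Perm (Fin m), if I ∘ σ = J then c σ else 0 := hc I J
  have hy := congrArg (⋀[R]^m M).subtype (sum_exteriorCoord_smul_ιMulti B y)
  rw [map_nsmul, Submodule.subtype_apply, Submodule.subtype_apply, sum_arrow_prod] at hy
  rw [← hy]
  simp only [contraction, Finset.smul_sum]
  rw [Submodule.coe_sum]
  refine (Finset.sum_congr rfl fun I _ => ?_).trans Finset.sum_comm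
  simp only [hcoord, Finset.sum_smul, ite_smul, zero_smul]
  rw [Finset.sum_comm, Submodule.coe_sum]
  refine Finset.sum_congr rfl fun σ _ => ?_
  rw [Finset.sum_ite_eq, if_pos (Finset.mem_univ _), ← coe_ιMulti_eq_edgeProd]
  rfl

end CommRing

variable {K M κ : Type*} [Field K] [CharZero K] [AddCommGroup M] [Module K M] [Fintype κ]
  [DecidableEq κ]

theorem coe_mem_adjoin_trace_pow_of_map_eq (B : Module.Basis (κ × κ) K M) {m : ℕ} {y : ⋀[K]^m M}
    (hy : ∀ g : GL κ K, exteriorPower.map m (conjMap B g) y = y) :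
    (y : ExteriorAlgebra K M) ∈ Algebra.adjoin K (Set.range fun k => (formMatrix B ^ k).trace) := by
  obtain ⟨c, hc⟩ := exists_eq_sum_perm_of_commute_tensorPowMatrix (coordMatrix B y) fun g =>
    commute_coordMatrix B (hy g)
  have hmem : m.factorial • (y : ExteriorAlgebra K M) ∈
      Algebra.adjoin K (Set.range fun k => (formMatrix B ^ k).trace) := by
    rw [factorial_nsmul_eq_sum_smul_contraction B y hc]
    exact sum_mem fun σ _ => Subalgebra.smul_mem _
      (contraction_mem_adjoin (formMatrix_mem B) (isCycleCover_perm σ)) _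
  rw [← Nat.cast_smul_eq_nsmul K] at hmem
  exact ((Subalgebra.toSubmodule (Algebra.adjoin K _)).smul_mem_iff
    (Nat.cast_ne_zero.2 m.factorial_ne_zero)).1 hmem

/-- First fundamental theorem for the conjugation action of `GL κ K` on matrices of 1-forms. -/
theorem mem_adjoin_trace_pow_of_map_eq (B : Module.Basis (κ × κ) K M) {x : ExteriorAlgebra K M}
    (hx : ∀ g : GL κ K, ExteriorAlgebra.map (conjMap B g) x = x) :
    x ∈ Algebra.adjoin K (Set.range fun k => (formMatrix B ^ k).trace) := by
  classical
  rw [← DirectSum.sum_support_decompose (fun i => ⋀[K]^i M) x]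
  refine sum_mem fun m _ => coe_mem_adjoin_trace_pow_of_map_eq B fun g => ?_
  rw [exteriorPower_map_decompose, hx]

end GLInvariants

section AnticommutingFamily

open Module

theorem basis_mul_basis_compl_of_not_subset {R M I : Type*} [CommRing R] [AddCommGroup M]
    [Module R M] [LinearOrder I] [Fintype I] (b : Basis I R M) {S T : Finset I} (h : ¬T ⊆ S) :
    b.ExteriorAlgebra T * b.ExteriorAlgebra Sᶜ = 0 :=
  ExteriorAlgebra.basis_mul_of_not_disjoint b (Set.powersetCard.ofCard (s := T) rfl)
    (Set.powersetCard.ofCard (s := Sᶜ) rfl) fun hd => h (disjoint_compl_right_iff.1 hd)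

theorem exists_basis_mul_basis_compl_eq_units_smul {R M I : Type*} [CommRing R] [AddCommGroup M]
    [Module R M] [LinearOrder I] [Fintype I] (b : Basis I R M) (S : Finset I) : ∃ u : ℤˣ,
      b.ExteriorAlgebra S * b.ExteriorAlgebra Sᶜ = u • b.ExteriorAlgebra Finset.univ := by
  have hd : Disjoint (Set.powersetCard.ofCard (s := S) rfl).val
      (Set.powersetCard.ofCard (s := Sᶜ) rfl).val := disjoint_compl_right
  have hunion : (Set.powersetCard.disjUnion hd : Finset I) = Finset.univ := by
    rw [Set.powersetCard.coe_disjUnion, Finset.disjUnion_eq_union]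
    exact Finset.union_compl S
  exact ⟨_, hunion ▸ ExteriorAlgebra.basis_mul_of_disjoint b _ _ hd⟩

theorem injective_of_map_basis_univ_ne_zero {K M I A : Type*} [Field K] [AddCommGroup M]
    [Module K M] [LinearOrder I] [Fintype I] [Ring A] [Algebra K A] (b : Basis I K M)
    (F : ExteriorAlgebra K M →ₐ[K] A) (h : F (b.ExteriorAlgebra Finset.univ) ≠ 0) :
    Function.Injective F := by
  refine (injective_iff_map_eq_zero F).2 fun x hx => by_contra fun hx0 => ?_
  have hsupp : (b.ExteriorAlgebra.repr x).support.Nonempty := by simpa using hx0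
  obtain ⟨S, hS, hmin⟩ := Finset.exists_min_image _ Finset.card hsupp
  have hmul : x * b.ExteriorAlgebra Sᶜ = b.ExteriorAlgebra.repr x S •
      (b.ExteriorAlgebra S * b.ExteriorAlgebra Sᶜ) := by
    conv_lhs => rw [← b.ExteriorAlgebra.sum_repr x, Finset.sum_mul]
    simp only [smul_mul_assoc]
    refine Finset.sum_eq_single S (fun T _ hTS => ?_) (by simp)
    by_cases hT : T ∈ (b.ExteriorAlgebra.repr x).support
    · rw [basis_mul_basis_compl_of_not_subset b, smul_zero]
      exact fun hsub => hTS (Finset.eq_of_subset_of_card_le hsub (hmin T hT))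
    · rw [Finsupp.notMem_support_iff.1 hT, zero_smul]
  obtain ⟨u, hu⟩ := exists_basis_mul_basis_compl_eq_units_smul b S
  have hzero := congrArg F hmul
  rw [map_mul, hx, zero_mul, hu, map_smul, Units.smul_def, map_zsmul, ← Units.smul_def] at hzero
  exact smul_ne_zero (Finsupp.mem_support_iff.1 hS) ((smul_ne_zero_iff_ne u).2 h) hzero.symm

variable {K ι A : Type*} [Field K] [CharZero K] [Fintype ι] [Ring A] [Algebra K A]
  {a : ι → A}

/-- The homomorphism from the exterior algebra on `K ^ ι` which sends the standard basis to a given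
anticommuting family. -/
def anticommLift (a : ι → A) (h : ∀ i j, a i * a j = -(a j * a i)) :
    ExteriorAlgebra K (ι → K) →ₐ[K] A :=
  ExteriorAlgebra.lift K ⟨Fintype.linearCombination K a, fun v => by
    have : IsAddTorsionFree A := .of_isTorsionFree K A
    refine self_eq_neg.1 ?_
    simp only [Fintype.linearCombination_apply, Finset.sum_mul_sum, ← Finset.sum_neg_distrib]
    rw [Finset.sum_comm]
    refine Finset.sum_congr rfl fun i _ => Finset.sum_congr rfl fun j _ => ?_
    rw [smul_mul_smul_comm, smul_mul_smul_comm, h, smul_neg, mul_comm]⟩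

variable (h : ∀ i j, a i * a j = -(a j * a i))

theorem anticommLift_ι_single [DecidableEq ι] (i : ι) :
    anticommLift a h (ExteriorAlgebra.ι K (Pi.single i 1)) = a i := by
  rw [anticommLift, ExteriorAlgebra.lift_ι_apply, Fintype.linearCombination_apply_single, one_smul]

theorem anticommLift_basis [LinearOrder ι] (S : Finset ι) :
    anticommLift a h ((Pi.basisFun K ι).ExteriorAlgebra S) =
      ((S.sort (· ≤ ·)).map a).prod := by
  rw [ExteriorAlgebra.basis_apply_ofCard _ rfl, ExteriorAlgebra.ιMulti_family,
    ExteriorAlgebra.ιMulti_apply, map_list_prod, List.map_ofFn, List.ofFn_eq_map,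
    ← Finset.listMap_orderEmbOfFin_finRange S rfl, List.map_map]
  refine congrArg List.prod (List.map_congr_left fun k _ => ?_)
  exact (congrArg _ (congrArg _ (Pi.basisFun_apply K ι _))).trans (anticommLift_ι_single h _)

theorem range_anticommLift :
    (anticommLift (K := K) a h).range = Algebra.adjoin K (Set.range a) := by
  classical
  apply le_antisymm
  · rw [← Algebra.map_top, ← CliffordAlgebra.adjoin_range_ι, AlgHom.map_adjoin]
    refine Algebra.adjoin_le ?_
    rintro _ ⟨_, ⟨v, rfl⟩, rfl⟩
    change anticommLift a h (ExteriorAlgebra.ι K v) ∈ _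
    rw [anticommLift, ExteriorAlgebra.lift_ι_apply, Fintype.linearCombination_apply]
    exact sum_mem fun i _ => Subalgebra.smul_mem _ (Algebra.subset_adjoin (Set.mem_range_self i)) _
  · refine Algebra.adjoin_le ?_
    rintro _ ⟨i, rfl⟩
    exact (AlgHom.mem_range _).2 ⟨_, anticommLift_ι_single h i⟩

theorem span_sort_prod_eq_range_anticommLift [LinearOrder ι] :
    Submodule.span K (Set.range fun S : Finset ι => ((S.sort (· ≤ ·)).map a).prod) =
      Subalgebra.toSubmodule (anticommLift a h).range := by
  rw [← Algebra.map_top, Subalgebra.map_toSubmodule, Algebra.top_toSubmodule,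
    ← (Pi.basisFun K ι).ExteriorAlgebra.span_eq, Submodule.map_span, ← Set.range_comp]
  refine congrArg _ (congrArg _ (funext fun S => ?_))
  exact (anticommLift_basis h S).symm

theorem exists_algEquiv_apply_ι_single_eq [DecidableEq ι]
    (hinj : Function.Injective (anticommLift (K := K) a h)) {S : Subalgebra K A}
    (hS : Algebra.adjoin K (Set.range a) = S) : ∃ Φ : ExteriorAlgebra K (ι → K) ≃ₐ[K] S,
      ∀ i, (Φ (ExteriorAlgebra.ι K (Pi.single i 1)) : A) = a i :=
  ⟨(AlgEquiv.ofInjective _ hinj).trans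
    (Subalgebra.equivOfEq _ _ ((range_anticommLift h).trans hS)), anticommLift_ι_single h⟩

theorem linearIndependent_sort_prod [LinearOrder ι]
    (hinj : Function.Injective (anticommLift (K := K) a h)) :
    LinearIndependent K fun S : Finset ι => ((S.sort (· ≤ ·)).map a).prod := by
  have := (Pi.basisFun K ι).ExteriorAlgebra.linearIndependent.map_injOn
    (anticommLift a h).toLinearMap hinj.injOn
  simpa only [Function.comp_def, AlgHom.toLinearMap_apply, anticommLift_basis] using this

theorem ker_freeAlgebra_lift_eq_span_anticomm
    (hinj : Function.Injective (anticommLift (K := K) a h)) :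
    TwoSidedIdeal.ker (FreeAlgebra.lift K a) = TwoSidedIdeal.span {r | ∃ i j : ι,
      r = FreeAlgebra.ι K i * FreeAlgebra.ι K j + FreeAlgebra.ι K j * FreeAlgebra.ι K i} := by
  classical
  set I := TwoSidedIdeal.span {r | ∃ i j : ι,
    r = FreeAlgebra.ι K i * FreeAlgebra.ι K j + FreeAlgebra.ι K j * FreeAlgebra.ι K i}
  refine le_antisymm (fun x hx => ?_) (TwoSidedIdeal.span_le.2 ?_)
  · let π : FreeAlgebra K ι →ₐ[K] I.ringCon.Quotient := I.ringCon.mkₐ (α := K)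
    have hπ (y : FreeAlgebra K ι) : π y = 0 ↔ y ∈ I := by
      conv_rhs => rw [← TwoSidedIdeal.ker_ringCon_mk' I, TwoSidedIdeal.mem_ker]
      rfl
    have hanti (i j : ι) : π (.ι K i) * π (.ι K j) = -(π (.ι K j) * π (.ι K i)) := by
      rw [eq_neg_iff_add_eq_zero, ← map_mul, ← map_mul, ← map_add, hπ]
      exact TwoSidedIdeal.subset_span ⟨i, j, rfl⟩
    let L : FreeAlgebra K ι →ₐ[K] ExteriorAlgebra K (ι → K) :=
      FreeAlgebra.lift K fun i => ExteriorAlgebra.ι K (Pi.single i 1)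
    have hL : (anticommLift a h).comp L = FreeAlgebra.lift K a := by
      ext i
      simp [L, anticommLift_ι_single]
    have hLπ : (anticommLift _ hanti).comp L = π := by
      ext i
      simp [L, anticommLift_ι_single]
    have hLx : L x = 0 := hinj <| by
      rw [map_zero, ← AlgHom.comp_apply, hL]
      exact TwoSidedIdeal.mem_ker _ |>.1 hx
    rw [← hπ, ← hLπ, AlgHom.comp_apply, hLx, map_zero]
  · rintro _ ⟨i, j, rfl⟩
    rw [SetLike.mem_coe, TwoSidedIdeal.mem_ker, map_add, map_mul, map_mul]
    simp only [FreeAlgebra.lift_ι_apply]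
    rw [h, neg_add_cancel]

end AnticommutingFamily

section TopDegree

open Module

theorem alternatingMap_apply_eq_det_smul {R M N ι : Type*} [CommRing R] [AddCommGroup M]
    [Module R M] [AddCommGroup N] [Module R N] [Fintype ι] [DecidableEq ι] (B : Basis ι R M)
    (f : M [⋀^ι]→ₗ[R] N) (v : ι → M) : f v = B.det v • f B := by
  suffices h : f = (LinearMap.toSpanSingleton R N (f B)).compAlternatingMap B.det from
    congrArg (fun g : M [⋀^ι]→ₗ[R] N => g v) h
  refine B.ext_alternating fun v hv => ?_
  let σ : Equiv.Perm ι := Equiv.ofBijective v (Finite.injective_iff_bijective.1 hv)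
  have hσ : (fun i => B (v i)) = B ∘ σ := rfl
  rw [hσ, AlternatingMap.map_perm, AlternatingMap.map_perm, LinearMap.compAlternatingMap_apply,
    B.det_self, LinearMap.toSpanSingleton_apply, one_smul]

theorem map_ιMulti_basis {R M : Type*} [CommRing R] [AddCommGroup M] [Module R M] {m : ℕ}
    (B : Basis (Fin m) R M) (f : M →ₗ[R] M) :
    ExteriorAlgebra.map f (ExteriorAlgebra.ιMulti R m B) =
      LinearMap.det f • ExteriorAlgebra.ιMulti R m B := by
  rw [ExteriorAlgebra.map_apply_ιMulti, alternatingMap_apply_eq_det_smul B, B.det_comp,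
    B.det_self, mul_one]

theorem ιMulti_basis_ne_zero {R M : Type*} [CommRing R] [Nontrivial R] [AddCommGroup M]
    [Module R M] {m : ℕ} (B : Basis (Fin m) R M) : ExteriorAlgebra.ιMulti R m B ≠ 0 := fun h => by
  have hdet := ExteriorAlgebra.liftAlternating_apply_ιMulti
    (Pi.single (M := fun i => M [⋀^Fin i]→ₗ[R] R) m B.det) B
  rw [h, map_zero, Pi.single_eq_same, B.det_self] at hdet
  exact zero_ne_one hdet

theorem exists_degree_eq_of_mem_span {K A ι : Type*} [CommRing K] [Ring A] [Algebra K A]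
    {𝒜 : ℕ → Submodule K A} [GradedAlgebra 𝒜] {a : ι → A} {d : ι → ℕ} (ha : ∀ i, a i ∈ 𝒜 (d i))
    {m : ℕ} {x : A} (hx : x ∈ 𝒜 m) (hx0 : x ≠ 0) (hspan : x ∈ Submodule.span K (Set.range a)) :
    ∃ i, d i = m ∧ a i ≠ 0 := by
  by_contra! h
  let π : A →ₗ[K] 𝒜 m :=
    DirectSum.component K ℕ (fun i => 𝒜 i) m ∘ₗ (DirectSum.decomposeLinearEquiv 𝒜).toLinearMap
  have hker : Submodule.span K (Set.range a) ≤ LinearMap.ker π := by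
    refine Submodule.span_le.2 ?_
    rintro _ ⟨i, rfl⟩
    by_cases hi : d i = m
    · rw [h i hi]
      exact zero_mem _
    · exact Subtype.ext (DirectSum.decompose_of_mem_ne 𝒜 (ha i) hi)
  refine hx0 ?_
  rw [← DirectSum.decompose_of_mem_same 𝒜 hx]
  exact congrArg Subtype.val (hker hspan)

theorem sum_univ_odd (n : ℕ) : ∑ i : Fin n, (2 * (i : ℕ) + 1) = n * n := by
  rw [Fin.sum_univ_eq_sum_range (fun i => 2 * i + 1) n]
  induction n with
  | zero => rfl
  | succ n ih => rw [Finset.sum_range_succ, ih]; ring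

theorem eq_univ_of_sum_odd_eq {n : ℕ} {S : Finset (Fin n)}
    (hS : ∑ i ∈ S, (2 * (i : ℕ) + 1) = n * n) : S = Finset.univ := by
  by_contra hne
  obtain ⟨i, -, hi⟩ := Finset.exists_of_ssubset (Finset.ssubset_univ_iff.2 hne)
  have hlt := Finset.sum_lt_sum_of_subset (f := fun i : Fin n => 2 * (i : ℕ) + 1)
    S.subset_univ (Finset.mem_univ i) hi (Nat.succ_pos _) fun _ _ _ => Nat.zero_le _
  exact hlt.ne (hS.trans (sum_univ_odd n).symm)

section CommRing

variable {R M : Type*} [CommRing R] [AddCommGroup M] [Module R M] {n : ℕ}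
  (B : Basis (Fin n × Fin n) R M)

/-- The traces of the odd powers of `formMatrix B` below `2 * n`. -/
noncomputable def oddTrace (i : Fin n) : ExteriorAlgebra R M :=
  (formMatrix B ^ (2 * (i : ℕ) + 1)).trace

theorem oddTrace_anticomm (i j : Fin n) :
    oddTrace B i * oddTrace B j = -(oddTrace B j * oddTrace B i) :=
  trace_pow_anticomm (formMatrix_mem B) (odd_two_mul_add_one _) (odd_two_mul_add_one _)

theorem oddTrace_prod_mem (S : Finset (Fin n)) :
    ((S.sort (· ≤ ·)).map (oddTrace B)).prod ∈ ⋀[R]^(∑ i ∈ S, (2 * (i : ℕ) + 1)) M := by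
  have h := SetLike.list_prod_map_mem_graded (A := fun i : ℕ => ⋀[R]^i M) (S.sort (· ≤ ·))
    (fun i : Fin n => 2 * (i : ℕ) + 1) (oddTrace B)
    fun i _ => trace_pow_mem_exteriorPower (formMatrix_mem B) _
  rwa [← List.sum_toFinset _ (Finset.sort_nodup _ _), Finset.sort_toFinset] at h

/-- The elements of the exterior algebra which are invariant under conjugation of the matrix of
1-forms `formMatrix B`. For the basis `e_i ⊗ e_j^*` of `V ⊗ V*`, these are the invariants of
`GL(V)`. -/
noncomputable def conjInvariants : Subalgebra R (ExteriorAlgebra R M) :=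
  ⨅ g : GL (Fin n) R, AlgHom.equalizer (ExteriorAlgebra.map (conjMap B g)) (AlgHom.id R _)

theorem mem_conjInvariants {x : ExteriorAlgebra R M} :
    x ∈ conjInvariants B ↔ ∀ g : GL (Fin n) R, ExteriorAlgebra.map (conjMap B g) x = x :=
  Algebra.mem_iInf

end CommRing

variable {K M : Type*} [Field K] [CharZero K] [AddCommGroup M] [Module K M] {n : ℕ}
  (B : Basis (Fin n × Fin n) K M)

theorem adjoin_oddTrace_eq_conjInvariants :
    Algebra.adjoin K (Set.range (oddTrace B)) = conjInvariants B := by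
  refine le_antisymm (Algebra.adjoin_le (Set.range_subset_iff.2 fun i => ?_)) fun x hx => ?_
  · exact (mem_conjInvariants B).2 fun g => map_conjMap_trace_pow B g _
  · have : IsAddTorsionFree (ExteriorAlgebra K M) := .of_isTorsionFree K _
    refine Algebra.adjoin_le (Set.range_subset_iff.2 fun k => ?_)
      (mem_adjoin_trace_pow_of_map_eq B ((mem_conjInvariants B).1 hx))
    have hk := trace_pow_mem_adjoin (formMatrix_mem B) k
    rwa [Fintype.card_fin] at hk

/-- The top form is invariant, hence a combination of the ordered products; by degree only the full
product can contribute to it. -/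
theorem oddTrace_prod_univ_ne_zero :
    ((Finset.univ.sort (· ≤ ·)).map (oddTrace B)).prod ≠ 0 := by
  let B' := B.reindex finProdFinEquiv
  have hmem : ExteriorAlgebra.ιMulti K (n * n) B' ∈ Algebra.adjoin K (Set.range (oddTrace B)) :=
    adjoin_oddTrace_eq_conjInvariants B ▸ (mem_conjInvariants B).2 fun g => by
      rw [map_ιMulti_basis, det_conjMap, one_smul]
  rw [← range_anticommLift (oddTrace_anticomm B), ← Subalgebra.mem_toSubmodule,
    ← span_sort_prod_eq_range_anticommLift] at hmem
  obtain ⟨S, hS, hne⟩ := exists_degree_eq_of_mem_span (𝒜 := fun i : ℕ => ⋀[K]^i M)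
    (oddTrace_prod_mem B) (ExteriorAlgebra.ιMulti_range K (n * n) (Set.mem_range_self _))
    (ιMulti_basis_ne_zero B') hmem
  rwa [eq_univ_of_sum_odd_eq hS] at hne

theorem anticommLift_oddTrace_injective :
    Function.Injective (anticommLift (K := K) (oddTrace B) (oddTrace_anticomm B)) := by
  refine injective_of_map_basis_univ_ne_zero (Pi.basisFun K (Fin n)) _ ?_
  rw [anticommLift_basis]
  exact oddTrace_prod_univ_ne_zero B

end TopDegree

section TensorDual

variable {V : Type*} [AddCommGroup V] [Module ℂ V] {n : ℕ} (b : Module.Basis (Fin n) ℂ V)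

/-- The basis `e_i ⊗ e_j^*` of `V ⊗ V*`. -/
noncomputable def tensorBasis : Module.Basis (Fin n × Fin n) ℂ (V ⊗[ℂ] Module.Dual ℂ V) :=
  b.tensorProduct b.dualBasis

theorem formMatrix_tensorBasis : formMatrix (tensorBasis b) = X b := by
  ext i j
  rw [formMatrix, Matrix.of_apply, tensorBasis, Module.Basis.tensorProduct_apply,
    Module.Basis.coe_dualBasis]
  rfl

theorem oddTrace_tensorBasis :
    oddTrace (tensorBasis b) = fun i : Fin n => q b (2 * (i : ℕ) + 1) := by
  funext i
  rw [oddTrace, formMatrix_tensorBasis, q]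

/-- The matrix of an element of `GL(V)`. -/
noncomputable def glMatrix : LinearMap.GeneralLinearGroup ℂ V ≃* GL (Fin n) ℂ :=
  Units.mapEquiv (LinearMap.toMatrixAlgEquiv b).toMulEquiv

theorem tensorDualRep_eq_conjMap (g : LinearMap.GeneralLinearGroup ℂ V) :
    tensorDualRep V g = conjMap (tensorBasis b) (glMatrix b g) := by
  rw [conjMap, ← LinearMap.toMatrix_symm, LinearEquiv.eq_symm_apply, ← map_inv]
  have hdual := LinearMap.toMatrix_transpose (B₁ := b) (B₂ := b) ((g⁻¹).1)
  exact (TensorProduct.toMatrix_map b b.dualBasis b b.dualBasis g.1 _).trans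
    (congrArg _ hdual)

/-- In the definition of `qProd`, the sorted list is coerced to a list of natural numbers. -/
theorem qProd_eq_sort_prod : qProd b = fun S : Finset (Fin n) =>
    ((S.sort (· ≤ ·)).map fun i : Fin n => q b (2 * (i : ℕ) + 1)).prod := by
  funext S
  simp only [qProd, List.pure_def, List.bind_eq_flatMap, ← List.map_eq_flatMap, List.map_map,
    Function.comp_def]

theorem conjInvariants_tensorBasis : conjInvariants (tensorBasis b) = invariants V := by
  ext x
  rw [mem_conjInvariants, (glMatrix b).surjective.forall]
  simp only [← tensorDualRep_eq_conjMap]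
  rfl

end TensorDual

end ExteriorInvariants

open ExteriorInvariants in
theorem theorem1p3_general {K M : Type*} [Field K] [CharZero K] [AddCommGroup M] [Module K M]
    {n : ℕ} (B : Module.Basis (Fin n × Fin n) K M) :
    Algebra.adjoin K (Set.range (oddTrace B)) = conjInvariants B ∧
    (∀ i j : Fin n, oddTrace B i * oddTrace B j = -(oddTrace B j * oddTrace B i)) ∧
    TwoSidedIdeal.ker (FreeAlgebra.lift K (oddTrace B)) = TwoSidedIdeal.span {r | ∃ i j : Fin n,
      r = FreeAlgebra.ι K i * FreeAlgebra.ι K j + FreeAlgebra.ι K j * FreeAlgebra.ι K i} ∧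
    (LinearIndependent K (fun S : Finset (Fin n) => ((S.sort (· ≤ ·)).map (oddTrace B)).prod) ∧
      Submodule.span K
          (Set.range fun S : Finset (Fin n) => ((S.sort (· ≤ ·)).map (oddTrace B)).prod) =
        Subalgebra.toSubmodule (conjInvariants B)) ∧
    (∃ Φ : ExteriorAlgebra K (Fin n → K) ≃ₐ[K] conjInvariants B,
      ∀ i : Fin n, (Φ (ExteriorAlgebra.ι K (Pi.single i 1)) : ExteriorAlgebra K M) =
        oddTrace B i) := by
  have hanti := oddTrace_anticomm B
  have hinj := anticommLift_oddTrace_injective B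
  have hgen := adjoin_oddTrace_eq_conjInvariants B
  refine ⟨hgen, hanti, ?_, ⟨?_, ?_⟩, ?_⟩
  · exact ker_freeAlgebra_lift_eq_span_anticomm hanti hinj
  · exact linearIndependent_sort_prod hanti hinj
  · rw [span_sort_prod_eq_range_anticommLift hanti, range_anticommLift, hgen]
  · exact exists_algEquiv_apply_ι_single_eq hanti hinj hgen

theorem theorem1p3 {V : Type*} [AddCommGroup V] [Module ℂ V] (n : ℕ)
    (b : Module.Basis (Fin n) ℂ V) :
    -- generation
    Algebra.adjoin ℂ (Set.range fun i : Fin n => ExteriorInvariants.q b (2 * (i : ℕ) + 1)) =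
        ExteriorInvariants.invariants V ∧
    -- anticommutativity
    (∀ i j : Fin n,
      ExteriorInvariants.q b (2 * (i : ℕ) + 1) * ExteriorInvariants.q b (2 * (j : ℕ) + 1) =
        -(ExteriorInvariants.q b (2 * (j : ℕ) + 1) *
          ExteriorInvariants.q b (2 * (i : ℕ) + 1))) ∧
    -- no other relations
    TwoSidedIdeal.ker (ExteriorInvariants.qHom b) = ExteriorInvariants.anticommIdeal n ∧
    -- the ordered products form a linear basis of the algebra of invariants
    (LinearIndependent ℂ (ExteriorInvariants.qProd b) ∧
      Submodule.span ℂ (Set.range (ExteriorInvariants.qProd b)) =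
        Subalgebra.toSubmodule (ExteriorInvariants.invariants V)) ∧
    -- the algebra of invariants is an exterior algebra on these generators
    (∃ Φ : ExteriorAlgebra ℂ (Fin n → ℂ) ≃ₐ[ℂ] ExteriorInvariants.invariants V,
      ∀ i : Fin n,
        ((Φ (ExteriorAlgebra.ι ℂ (Pi.single i 1)) : ExteriorInvariants.invariants V) :
          ExteriorInvariants.Ext V) = ExteriorInvariants.q b (2 * (i : ℕ) + 1)) := by
  rw [ExteriorInvariants.qHom, ExteriorInvariants.anticommIdeal,
    ExteriorInvariants.qProd_eq_sort_prod, ← ExteriorInvariants.conjInvariants_tensorBasis b]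
  simpa only [ExteriorInvariants.oddTrace_tensorBasis] using
    theorem1p3_general (ExteriorInvariants.tensorBasis b)
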